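/- Let $n\in\mathbb{N}$, let $F\colon\mathbb{R}^n\rightrightarrows\mathbb{R}^n$ be a set-valued mapping, let $\operatorname{gph}F:=\{(x,v)\in\mathbb{R}^n\times\mathbb{R}^n \mid v\in F(x)\}$, and let $(\bar x,\bar v)\in\operatorname{gph}F$. Suppose that $\operatorname{gph}F$ is closed around $(\bar x,\bar v)$, i.e., $W\cap\operatorname{gph}F$ is closed for some closed neighborhood $W$ of $(\bar x,\bar v)$. Suppose also that $F$ is strongly metrically subregular at $(\bar x,\bar v)$, i.e., there are $\mu>0$ and a neighborhood $U$ of $\bar x$ such that, with $F^{-1}(\bar v):=\{x\in\mathbb{R}^n\mid \bar v\in F(x)\}$, $$\operatorname{dist}\big(x;F^{-1}(\bar v)\big)\le\mu\,\operatorname{dist}\big(\bar v;F(x)\big)\ \text{ for all } x\in U,\qquad\text{and}\qquad F^{-1}(\bar v)\cap U=\{\bar x\},$$ where $\operatorname{dist}(\bar v;\emptyset):=\infty$. Then there exists $d\in\mathbb{R}^n$ such that $$-\bar v\in D^*F(\bar x,\bar v)(d).$$ Here $D^*F(\bar x,\bar v)(d):=\{u\in\mathbb{R}^n\mid (u,-d)\in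 N_{\operatorname{gph}F}(\bar x,\bar v)\}$ is the limiting coderivative. For a set $\Omega\subset\mathbb{R}^s$ and $\bar z\in\Omega$, the limiting normal cone $N_\Omega(\bar z)$ is the set of all $w\in\mathbb{R}^s$ for which there are sequences $z_k\to\bar z$ with $z_k\in\Omega$ and $w_k\to w$ such that $w_k\in\widehat N_\Omega(z_k)$ for all $k$, where, for $z'\in\Omega$, $$\widehat N_\Omega(z'):=\Big\{w\in\mathbb{R}^s\ \Big|\ \limsup_{z\to z',\ z\in\Omega\setminus\{z'\}}\frac{\langle w,z-z'\rangle}{\|z-z'\|}\le 0\Big\}$$ (all of $\mathbb{R}^s$ if $z'$ is an isolated point of $\Omega$). -/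

import Mathlib

open Filter Topology

noncomputable section

namespace VarAnalysis

/-- The limsup is taken in the extended reals over `z → z₀`, `z ∈ Ω`, `z ≠ z₀`
(so it is `⊥` if `z₀` is isolated in `Ω`, and then every vector is a regular normal). -/
def regularNormalCone {H : Type*} [NormedAddCommGroup H] [InnerProductSpace ℝ H]
    (Ω : Set H) (z₀ : H) : Set H :=
  {v | limsup (fun z => ((inner ℝ v (z - z₀) / ‖z - z₀‖ : ℝ) : EReal)) (𝓝[Ω \ {z₀}] z₀) ≤ 0}

/-- The usual `ε`-form of regular normality. -/
theorem mem_regularNormalCone_iff {H : Type*} [NormedAddCommGroup H] [InnerProductSpace ℝ H]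
    {Ω : Set H} {z₀ v : H} :
    v ∈ regularNormalCone Ω z₀ ↔
      ∀ ε : ℝ, 0 < ε → ∀ᶠ z in 𝓝[Ω] z₀, inner ℝ v (z - z₀) ≤ ε * ‖z - z₀‖ := by
  have key : ∀ ε : ℝ, (∀ᶠ z in 𝓝[Ω] z₀, inner ℝ v (z - z₀) ≤ ε * ‖z - z₀‖) ↔
      ∀ᶠ z in 𝓝[Ω \ {z₀}] z₀, inner ℝ v (z - z₀) / ‖z - z₀‖ ≤ ε := by
    intro ε
    simp only [eventually_nhdsWithin_iff]
    refine eventually_congr (Eventually.of_forall fun z => ?_)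
    by_cases hz : z = z₀
    · simp [hz]
    · have : 0 < ‖z - z₀‖ := norm_pos_iff.2 (sub_ne_zero.2 hz)
      simp [hz, div_le_iff₀ this]
  simp only [key]
  constructor
  · intro h ε hε
    have h' : limsup (fun z => ((inner ℝ v (z - z₀) / ‖z - z₀‖ : ℝ) : EReal))
        (𝓝[Ω \ {z₀}] z₀) < (ε : EReal) :=
      lt_of_le_of_lt h (by exact_mod_cast hε)
    filter_upwards [eventually_lt_of_limsup_lt h'] with z hz
    exact_mod_cast hz.le
  · intro h
    refine EReal.le_of_forall_lt_iff_le.1 fun ε hε => ?_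
    refine limsup_le_of_le (h := ?_)
    filter_upwards [h ε (by exact_mod_cast hε)] with z hz
    exact_mod_cast hz

def limitingNormalCone {H : Type*} [NormedAddCommGroup H] [InnerProductSpace ℝ H]
    (Ω : Set H) (z₀ : H) : Set H :=
  {v | ∃ (z w : ℕ → H), (∀ k, z k ∈ Ω) ∧ Tendsto z atTop (𝓝 z₀) ∧ Tendsto w atTop (𝓝 v) ∧
    ∀ k, w k ∈ regularNormalCone Ω (z k)}

/-- The set `Ω` is closed around `z₀`. -/
def ClosedAround {H : Type*} [TopologicalSpace H] (Ω : Set H) (z₀ : H) : Prop :=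
  ∃ W ∈ 𝓝 z₀, IsClosed W ∧ IsClosed (Ω ∩ W)

variable {n m : ℕ}

/-- The graph of a set-valued mapping, in the Euclidean space `ℝⁿ × ℝᵐ` (hence `WithLp 2`). -/
def gph (F : EuclideanSpace ℝ (Fin n) → Set (EuclideanSpace ℝ (Fin m))) :
    Set (WithLp 2 (EuclideanSpace ℝ (Fin n) × EuclideanSpace ℝ (Fin m))) :=
  {z | z.snd ∈ F z.fst}

/-- The inverse mapping `F⁻¹(y) = {x | y ∈ F x}`. -/
def inverse (F : EuclideanSpace ℝ (Fin n) → Set (EuclideanSpace ℝ (Fin m)))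
    (y : EuclideanSpace ℝ (Fin m)) : Set (EuclideanSpace ℝ (Fin n)) :=
  {x | y ∈ F x}

/-- The limiting coderivative `D*F(x₀, y₀)(v)`. -/
def limitingCoderivative (F : EuclideanSpace ℝ (Fin n) → Set (EuclideanSpace ℝ (Fin m)))
    (x₀ : EuclideanSpace ℝ (Fin n)) (y₀ v : EuclideanSpace ℝ (Fin m)) :
    Set (EuclideanSpace ℝ (Fin n)) :=
  {u | WithLp.toLp 2 (u, -v) ∈ limitingNormalCone (gph F) (WithLp.toLp 2 (x₀, y₀))}

/-- Strong metric subregularity at `(x₀, y₀)` with modulus `μ`. Distances are extended-real-valued,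
with the convention `dist(y; ∅) = ∞`. -/
def StronglyMetricallySubregularWith
    (F : EuclideanSpace ℝ (Fin n) → Set (EuclideanSpace ℝ (Fin m)))
    (x₀ : EuclideanSpace ℝ (Fin n)) (y₀ : EuclideanSpace ℝ (Fin m)) (μ : ℝ) : Prop :=
  y₀ ∈ F x₀ ∧ 0 < μ ∧ ∃ U ∈ 𝓝 x₀,
    (∀ x ∈ U, Metric.infEDist x (inverse F y₀) ≤ ENNReal.ofReal μ * Metric.infEDist y₀ (F x)) ∧
    inverse F y₀ ∩ U = {x₀}

/-- Strong metric subregularity at `(x₀, y₀)` (with some modulus). -/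
def StronglyMetricallySubregularAt
    (F : EuclideanSpace ℝ (Fin n) → Set (EuclideanSpace ℝ (Fin m)))
    (x₀ : EuclideanSpace ℝ (Fin n)) (y₀ : EuclideanSpace ℝ (Fin m)) : Prop :=
  ∃ μ : ℝ, StronglyMetricallySubregularWith F x₀ y₀ μ

end VarAnalysis

end

namespace VarAnalysis

/-! Strong subregularity bounds `‖x - x₀‖` by `μ * ‖y - y₀‖` on the graph near the base point. For
any `u`, minimize `-⟪u, x⟫ + (k + 1) ‖y - y₀‖²` over a compact piece of the graph. Comparison with
the base point gives `(k + 1) ‖y_k - y₀‖ ≤ ‖u‖ μ`, so the minimizers tend to the base point while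
the multipliers `2 (k + 1) (y_k - y₀)` stay bounded. Each late minimizer carries the regular normal
`(u, -2 (k + 1) (y_k - y₀))`; a subsequential limit of the multipliers is `d`. The choice `u = -v₀`
plays no special role. -/

/-- Near `x₀`, the distance to the fibre over `y₀` is the distance to `x₀` itself. -/
theorem StronglyMetricallySubregularAt.exists_norm_le {n m : ℕ}
    {F : EuclideanSpace ℝ (Fin n) → Set (EuclideanSpace ℝ (Fin m))}
    {x₀ : EuclideanSpace ℝ (Fin n)} {y₀ : EuclideanSpace ℝ (Fin m)}
    (h : StronglyMetricallySubregularAt F x₀ y₀) :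
    ∃ μ > 0, ∃ r > 0, ∀ x y, ‖x - x₀‖ ≤ r → y ∈ F x → ‖x - x₀‖ ≤ μ * ‖y - y₀‖ := by
  obtain ⟨μ, -, hμ, U, hU, hle, hiso⟩ := h
  obtain ⟨ρ, hρ, hball⟩ := Metric.mem_nhds_iff.1 hU
  -- With radius `ρ / 2`, fibre points outside `U` are at least `ρ / 2` from `x`, hence no closer to
  -- `x` than `x₀` is.
  refine ⟨μ, hμ, ρ / 2, half_pos hρ, fun x y hx hy => ?_⟩
  have hxU : x ∈ U := hball (by rw [Metric.mem_ball, dist_eq_norm]; linarith)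
  have h₁ : ENNReal.ofReal ‖x - x₀‖ ≤ Metric.infEDist x (inverse F y₀) := by
    refine Metric.le_infEDist.2 fun z hz => ?_
    rw [edist_dist]
    refine ENNReal.ofReal_le_ofReal ?_
    by_cases hzU : z ∈ U
    · have hz₀ : z ∈ ({x₀} : Set _) := hiso ▸ ⟨hz, hzU⟩
      rw [Set.mem_singleton_iff.1 hz₀, dist_eq_norm]
    · have hfar : ρ ≤ dist z x₀ := not_lt.1 fun hlt => hzU (hball hlt)
      have htri := dist_triangle_left z x₀ x
      rw [dist_eq_norm x x₀] at htri
      linarith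
  have h₂ : Metric.infEDist y₀ (F x) ≤ ENNReal.ofReal ‖y - y₀‖ := by
    rw [← dist_eq_norm, dist_comm, ← edist_dist]
    exact Metric.infEDist_le_edist_of_mem hy
  have h₃ : ENNReal.ofReal ‖x - x₀‖ ≤ ENNReal.ofReal (μ * ‖y - y₀‖) := by
    rw [ENNReal.ofReal_mul hμ.le]
    exact h₁.trans ((hle x hxU).trans (by gcongr))
  exact (ENNReal.ofReal_le_ofReal_iff (by positivity)).1 h₃

/-- A vector supporting `Ω` up to a quadratic error is a regular normal. -/
theorem mem_regularNormalCone_of_inner_le_sq {H : Type*} [NormedAddCommGroup H]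
    [InnerProductSpace ℝ H] {Ω : Set H} {z₀ w : H} {c : ℝ}
    (h : ∀ᶠ z in 𝓝[Ω] z₀, inner ℝ w (z - z₀) ≤ c * ‖z - z₀‖ ^ 2) :
    w ∈ regularNormalCone Ω z₀ := by
  refine mem_regularNormalCone_iff.2 fun ε hε => ?_
  have hsmall : ∀ᶠ z in 𝓝[Ω] z₀, c * ‖z - z₀‖ < ε := by
    refine (Tendsto.mono_left ?_ nhdsWithin_le_nhds).eventually_lt_const hε
    have hc : Continuous fun z : H => c * ‖z - z₀‖ := by fun_prop
    simpa using hc.tendsto z₀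
  filter_upwards [h, hsmall] with z hz hz'
  nlinarith [norm_nonneg (z - z₀)]

/-- Minimality of `z₁` for the penalized linear function `-⟪u, x⟫ + c ‖y - y₀‖²` yields
a regular normal. -/
theorem mem_regularNormalCone_of_isLocalMinOn {E G : Type*} [NormedAddCommGroup E]
    [InnerProductSpace ℝ E] [NormedAddCommGroup G] [InnerProductSpace ℝ G]
    {Ω : Set (WithLp 2 (E × G))} {z₁ : WithLp 2 (E × G)} {u : E} {y₀ : G} {c : ℝ} (hc : 0 ≤ c)
    (h : IsLocalMinOn (fun z : WithLp 2 (E × G) => -inner ℝ u z.fst + c * ‖z.snd - y₀‖ ^ 2)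
      Ω z₁) :
    WithLp.toLp 2 (u, -((2 * c) • (z₁.snd - y₀))) ∈ regularNormalCone Ω z₁ := by
  refine mem_regularNormalCone_of_inner_le_sq (c := c) ?_
  filter_upwards [h] with z hz
  -- The cross term, scaled by `c`, pairs with the second component of the normal; `c ‖z.snd -
  -- z₁.snd‖ ^ 2` is the quadratic error.
  have hexp : ‖z.snd - y₀‖ ^ 2 = ‖z.snd - z₁.snd‖ ^ 2
      + 2 * inner ℝ (z.snd - z₁.snd) (z₁.snd - y₀) + ‖z₁.snd - y₀‖ ^ 2 := by
    rw [← sub_add_sub_cancel z.snd z₁.snd y₀, norm_add_sq_real]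
  have hnorm : ‖z - z₁‖ ^ 2 = ‖z.fst - z₁.fst‖ ^ 2 + ‖z.snd - z₁.snd‖ ^ 2 := by
    rw [WithLp.prod_norm_sq_eq_of_L2]; rfl
  rw [WithLp.prod_inner_apply, hnorm]
  simp only [WithLp.ofLp_sub, Prod.fst_sub, Prod.snd_sub, inner_neg_left, real_inner_smul_left]
  have hz' : -inner ℝ u z₁.fst + c * ‖z₁.snd - y₀‖ ^ 2
      ≤ -inner ℝ u z.fst + c * ‖z.snd - y₀‖ ^ 2 := hz
  rw [hexp] at hz'
  change inner ℝ u (z.fst - z₁.fst) + -(2 * c * inner ℝ (z₁.snd - y₀) (z.snd - z₁.snd)) ≤ _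
  rw [inner_sub_right, real_inner_comm (z.snd - z₁.snd)]
  nlinarith [mul_nonneg hc (sq_nonneg ‖z.fst - z₁.fst‖)]

/-- If `‖x - x₀‖ ≤ μ ‖y - y₀‖` for `(x, y) ∈ Ω` near `(x₀, y₀)`, then every `u` is the first
component of a limiting normal to `Ω` at `(x₀, y₀)`. -/
theorem exists_mem_limitingNormalCone_of_norm_le {E G : Type*} [NormedAddCommGroup E]
    [InnerProductSpace ℝ E] [FiniteDimensional ℝ E] [NormedAddCommGroup G]
    [InnerProductSpace ℝ G] [FiniteDimensional ℝ G]
    {Ω : Set (WithLp 2 (E × G))} {x₀ : E} {y₀ : G} (hmem : WithLp.toLp 2 (x₀, y₀) ∈ Ω)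
    (hclosed : ClosedAround Ω (WithLp.toLp 2 (x₀, y₀))) {μ : ℝ} (hμ : 0 ≤ μ)
    (hle : ∀ᶠ z in 𝓝[Ω] (WithLp.toLp 2 (x₀, y₀)), ‖z.fst - x₀‖ ≤ μ * ‖z.snd - y₀‖) (u : E) :
    ∃ d : G, WithLp.toLp 2 (u, -d) ∈ limitingNormalCone Ω (WithLp.toLp 2 (x₀, y₀)) := by
  set z₀ : WithLp 2 (E × G) := WithLp.toLp 2 (x₀, y₀)
  obtain ⟨W, hW, -, hΩW⟩ := hclosed
  obtain ⟨r, hr, hball⟩ := Metric.nhds_basis_closedBall.mem_iff.1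
    (inter_mem hW (eventually_nhdsWithin_iff.1 hle))
  have hcompact : IsCompact (Ω ∩ Metric.closedBall z₀ r) := by
    have : ProperSpace (WithLp 2 (E × G)) := FiniteDimensional.proper_real _
    have heq : Ω ∩ Metric.closedBall z₀ r = (Ω ∩ W) ∩ Metric.closedBall z₀ r := by
      ext z
      exact ⟨fun hz => ⟨⟨hz.1, (hball hz.2).1⟩, hz.2⟩, fun hz => ⟨hz.1.1, hz.2⟩⟩
    rw [heq]
    exact (isCompact_closedBall z₀ r).inter_left hΩW
  have hmin : ∀ k : ℕ, ∃ z ∈ Ω ∩ Metric.closedBall z₀ r, IsMinOn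
      (fun z : WithLp 2 (E × G) => -inner ℝ u z.fst + ((k : ℝ) + 1) * ‖z.snd - y₀‖ ^ 2)
      (Ω ∩ Metric.closedBall z₀ r) z := fun k =>
    hcompact.exists_isMinOn ⟨z₀, hmem, Metric.mem_closedBall_self hr.le⟩ (by fun_prop)
  choose z hz hzmin using hmin
  have hzx : ∀ k, ‖(z k).fst - x₀‖ ≤ μ * ‖(z k).snd - y₀‖ := fun k =>
    (hball (hz k).2).2 (hz k).1
  have hzy : ∀ k : ℕ, ((k : ℝ) + 1) * ‖(z k).snd - y₀‖ ≤ ‖u‖ * μ := by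
    intro k
    have h₁ : -inner ℝ u (z k).fst + ((k : ℝ) + 1) * ‖(z k).snd - y₀‖ ^ 2
        ≤ -inner ℝ u x₀ + ((k : ℝ) + 1) * ‖y₀ - y₀‖ ^ 2 :=
      hzmin k ⟨hmem, Metric.mem_closedBall_self hr.le⟩
    have h₂ : inner ℝ u (z k).fst - inner ℝ u x₀ ≤ ‖u‖ * (μ * ‖(z k).snd - y₀‖) := by
      rw [← inner_sub_right]
      exact (real_inner_le_norm _ _).trans (by gcongr; exact hzx k)
    rw [sub_self, norm_zero] at h₁
    -- The comparison bounds a quadratic in `‖y_k - y₀‖` by a linear term, so one factor cancels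
    -- unless it vanishes.
    rcases (norm_nonneg ((z k).snd - y₀)).eq_or_lt with h₀ | h₀
    · rw [← h₀, mul_zero]; positivity
    · refine le_of_mul_le_mul_right ?_ h₀
      nlinarith
  have hy : Tendsto (fun k => (z k).snd) atTop (𝓝 y₀) := by
    rw [tendsto_iff_norm_sub_tendsto_zero]
    refine squeeze_zero (fun _ => norm_nonneg _) (fun k => ?_)
      (by simpa using (tendsto_one_div_add_atTop_nhds_zero_nat (𝕜 := ℝ)).const_mul (‖u‖ * μ))
    rw [← div_eq_mul_inv, le_div_iff₀ (by positivity), mul_comm]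
    exact hzy k
  have hx : Tendsto (fun k => (z k).fst) atTop (𝓝 x₀) := by
    rw [tendsto_iff_norm_sub_tendsto_zero] at hy ⊢
    exact squeeze_zero (fun _ => norm_nonneg _) hzx (by simpa using hy.const_mul μ)
  have hzlim : Tendsto z atTop (𝓝 z₀) :=
    ((WithLp.prod_continuous_toLp 2 E G).tendsto (x₀, y₀)).comp (hx.prodMk_nhds hy)
  have hnormal : ∀ᶠ k in atTop, WithLp.toLp 2 (u, -((2 * ((k : ℝ) + 1)) • ((z k).snd - y₀)))
      ∈ regularNormalCone Ω (z k) := by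
    -- Once `z k` is in the open ball, the ball constraint is inactive and the minimum is local on
    -- `Ω`.
    filter_upwards [hzlim (Metric.ball_mem_nhds z₀ hr)] with k hk
    refine mem_regularNormalCone_of_isLocalMinOn (by positivity) ?_
    have hnhds : Metric.closedBall z₀ r ∈ 𝓝 (z k) :=
      mem_of_superset (Metric.isOpen_ball.mem_nhds hk) Metric.ball_subset_closedBall
    filter_upwards [self_mem_nhdsWithin, mem_nhdsWithin_of_mem_nhds hnhds] with z' h₁ h₂
    exact hzmin k ⟨h₁, h₂⟩
  -- Limiting normals require regular normals at every index, hence the shift by `N`.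
  obtain ⟨N, hN⟩ := eventually_atTop.1 hnormal
  obtain ⟨d, -, φ, hφ, hd⟩ := (isCompact_closedBall (0 : G) (2 * (‖u‖ * μ))).tendsto_subseq
    (x := fun k => (2 * (((k + N : ℕ) : ℝ) + 1)) • ((z (k + N)).snd - y₀)) (fun k => by
      rw [mem_closedBall_zero_iff, norm_smul, Real.norm_of_nonneg (by positivity), mul_assoc]
      exact mul_le_mul_of_nonneg_left (hzy _) zero_le_two)
  refine ⟨d, fun k => z (φ k + N), _, fun k => (hz _).1,
    hzlim.comp ((tendsto_add_atTop_nat N).comp hφ.tendsto_atTop), ?_,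
    fun k => hN (φ k + N) (Nat.le_add_left _ _)⟩
  exact ((WithLp.prod_continuous_toLp 2 E G).tendsto (u, -d)).comp
    (tendsto_const_nhds.prodMk_nhds hd.neg)

end VarAnalysis

theorem theorem3p1 (n : ℕ)
    (F : EuclideanSpace ℝ (Fin n) → Set (EuclideanSpace ℝ (Fin n)))
    (x₀ v₀ : EuclideanSpace ℝ (Fin n))
    (hmem : WithLp.toLp 2 (x₀, v₀) ∈ VarAnalysis.gph F)
    (hclosed : VarAnalysis.ClosedAround (VarAnalysis.gph F) (WithLp.toLp 2 (x₀, v₀)))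
    (hsub : VarAnalysis.StronglyMetricallySubregularAt F x₀ v₀) :
    ∃ d : EuclideanSpace ℝ (Fin n), -v₀ ∈ VarAnalysis.limitingCoderivative F x₀ v₀ d := by
  obtain ⟨μ, hμ, r, hr, hle⟩ := hsub.exists_norm_le
  refine VarAnalysis.exists_mem_limitingNormalCone_of_norm_le hmem hclosed hμ.le ?_ (-v₀)
  have hfst : Continuous fun z : WithLp 2 (EuclideanSpace ℝ (Fin n) × EuclideanSpace ℝ (Fin n)) =>
      ‖z.fst - x₀‖ := by fun_prop
  have hnear : ∀ᶠ z in 𝓝[VarAnalysis.gph F] (WithLp.toLp 2 (x₀, v₀)), ‖z.fst - x₀‖ < r :=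
    ((hfst.tendsto _).mono_left nhdsWithin_le_nhds).eventually_lt_const (by simpa using hr)
  filter_upwards [self_mem_nhdsWithin, hnear] with z hz hzr
  exact hle z.fst z.snd hzr.le hz
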